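/- Let $d,T\ge 1$, let $\mathcal X\subseteq\mathbb R^d$ be closed and convex, and let $f(\mathbf x)=\mathbb E_{\boldsymbol\xi}[f(\mathbf x;\boldsymbol\xi)]$, where for every value of $\boldsymbol\xi$ the function $f(\cdot;\boldsymbol\xi)$ is differentiable on $\mathbb R^d$ and, for constants $L_g>0$ and $\eta$, - (A1) $\|\nabla f(\mathbf x;\boldsymbol\xi)-\nabla f(\mathbf y;\boldsymbol\xi)\|\le L_g\|\mathbf x-\mathbf y\|$ for all $\mathbf x,\mathbf y\in\mathbb R^d$; - (A2) $\|\nabla f(\mathbf x;\boldsymbol\xi)\|_\infty\le\eta$ for all $\mathbf x\in\mathbb R^d$. Here $\|\cdot\|$ is the Euclidean norm. Let $\mu=1/\sqrt{Td}$ and let $f_\mu(\mathbf x)=\mathbb E_{\mathbf w}[f(\mathbf x+\mu\mathbf w)]$, with $\mathbf w$ uniform on the unit ball of $\mathbb R^d$. Let $\boldsymbol\xi_1,\boldsymbol\xi_2,\dots$ be i.i.d. copies of $\boldsymbol\xi$ and $\mathbf u_1,\mathbf u_2,\dots$ i.i.d. uniform on the unit sphere of $\mathbb R^d$, all mutually independent.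 ZO-AdaMM with $\beta_{1,t}=0$ and constant step size $\alpha_t=\alpha$ starts from a deterministic $\mathbf x_1\in\mathcal X$ and deterministic $\mathbf v_0,\hat{\mathbf v}_0$, with a parameter $\beta_2\in(0,1]$, and for $t=1,\dots,T$ sets (with coordinatewise operations) $$\hat{\mathbf g}_t=\tfrac{d}{\mu}\big[f(\mathbf x_t+\mu\mathbf u_t;\boldsymbol\xi_t)-f(\mathbf x_t;\boldsymbol\xi_t)\big]\mathbf u_t,\quad \mathbf v_t=\beta_2\mathbf v_{t-1}+(1-\beta_2)\hat{\mathbf g}_t^2,\quad \hat{\mathbf v}_t=\max(\hat{\mathbf v}_{t-1},\mathbf v_t),\quad \hat{\mathbf V}_t=\mathrm{diag}(\hat{\mathbf v}_t),$$ $$\mathbf x_{t+1}=\operatorname*{arg\,min}_{\mathbf x\in\mathcal X}\big\|\hat{\mathbf V}_t^{1/4}\big(\mathbf x-\mathbf x_t+\alpha\hat{\mathbf V}_t^{-1/2}\hat{\mathbf g}_t\big)\big\|^2 .$$ Suppose that $c>0$ and $\hat v_{0,i}^{1/2}\ge c$ for all $i$, that $f_\mu(\mathbf x_1)-\inf_{\mathbf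 x\in\mathcal X}f_\mu(\mathbf x)\le D_f$, and that $0<\alpha\le c/L_g$. Let $$\|\mathcal G(\mathbf x_t)\|^2=\big\|\hat{\mathbf V}_t^{1/4}(\mathbf x_t-\mathbf x_t^+)/\alpha\big\|^2,\qquad \mathbf x_t^+=\operatorname*{arg\,min}_{\mathbf x\in\mathcal X}\Big\{\langle\nabla f(\mathbf x_t),\mathbf x\rangle+\tfrac1{2\alpha}\|\hat{\mathbf V}_t^{1/4}(\mathbf x-\mathbf x_t)\|^2\Big\},$$ let $R$ be uniform on $\{1,\dots,T\}$ and independent of all $\boldsymbol\xi_t,\mathbf u_t$, and let $\sigma^2=\max_{1\le t\le T}\mathbb E\|\hat{\mathbf g}_t-\nabla f_\mu(\mathbf x_t)\|^2$. Then all the expectations involved are finite and $$\mathbb E\|\mathcal G(\mathbf x_R)\|^2\le\frac{6D_f}{\alpha T}+\frac{3L_g^2d}{4cT}+\frac{6\eta^2}{c^4T}\big(\sigma^2+d\eta^2\big)+\frac{3c+9}{c}\,\sigma^2 .$$ -/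

import Mathlib

open MeasureTheory ProbabilityTheory

noncomputable section

namespace ZOAdaMM

/-- The Euclidean space `ℝ^d`. -/
abbrev Vec (d : ℕ) : Type := EuclideanSpace ℝ (Fin d)

/-- The uniform distribution on the unit sphere of `ℝ^d`: the normalized surface measure, seen as a
measure on `ℝ^d`. -/
def uniformSphere (d : ℕ) : Measure (Vec d) :=
  ((volume : Measure (Vec d)).toSphere[|Set.univ]).map Subtype.val

/-- The objective `f(x) = E_ξ[f(x; ξ)]`, where `P` is the law of `ξ`. -/
def objective {d : ℕ} {Ξ : Type*} [MeasurableSpace Ξ] (P : Measure Ξ) (F : Vec d → Ξ → ℝ)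
    (x : Vec d) : ℝ :=
  ∫ s, F x s ∂P

/-- The smoothing function `f_μ(x) = E[f(x + μ u)]`, with `u` uniform on the unit ball. -/
def smoothing {d : ℕ} (μ : ℝ) (f : Vec d → ℝ) (x : Vec d) : ℝ :=
  ⨍ u in Metric.ball (0 : Vec d) 1, f (x + μ • u)

/-- The two-point zeroth-order gradient estimate `(d/μ) [f(x + μ u) - f(x)] u` along `u`. -/
def zoGrad {d : ℕ} (μ : ℝ) (f : Vec d → ℝ) (u x : Vec d) : Vec d :=
  ((d : ℝ) / μ * (f (x + μ • u) - f x)) • u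

/-- `‖H^{1/2} z‖²` for the diagonal matrix `H = diag(h)` with nonnegative entries. -/
def wsq {d : ℕ} (h : Fin d → ℝ) (z : Vec d) : ℝ :=
  ∑ i, h i * z i ^ 2

/-- The Mahalanobis projection `Π_{X,H}(a) = argmin_{x ∈ X} ‖H^{1/2} (x - a)‖²`, `H = diag(h)`. -/
def mahalanobisProj {d : ℕ} (X : Set (Vec d)) (h : Fin d → ℝ) (a : Vec d) : Vec d :=
  Classical.epsilon fun p => p ∈ X ∧ ∀ y ∈ X, wsq h (p - a) ≤ wsq h (y - a)

/-- `x⁺ = argmin_{x ∈ X} { ⟨g, x⟩ + (1/w) D_H(x, x⁻) }`, where `D_H(x, x⁻) = ‖H^{1/2} (x - x⁻)‖² / 2`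
and `H = diag(h)`. -/
def proxPoint {d : ℕ} (X : Set (Vec d)) (h : Fin d → ℝ) (xm g : Vec d) (w : ℝ) : Vec d :=
  Classical.epsilon fun p => p ∈ X ∧ ∀ y ∈ X,
    inner ℝ g p + 1 / w * (wsq h (p - xm) / 2) ≤ inner ℝ g y + 1 / w * (wsq h (y - xm) / 2)

/-- The gradient mapping `P_{X,H}(x⁻, g, w) = (x⁻ - x⁺) / w`. -/
def gradMapping {d : ℕ} (X : Set (Vec d)) (h : Fin d → ℝ) (xm g : Vec d) (w : ℝ) : Vec d :=
  w⁻¹ • (xm - proxPoint X h xm g w)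

/-- The variables of ZO-AdaMM: the iterate, the momentum, and the vectors `v` and `v̂`. -/
structure State (d : ℕ) where
  x : Vec d
  m : Vec d
  v : Fin d → ℝ
  vhat : Fin d → ℝ

/-- One iteration of ZO-AdaMM with step size `α`, parameters `β₁`, `β₂` and gradient estimate `g`. -/
def step {d : ℕ} (X : Set (Vec d)) (α β₁ β₂ : ℝ) (s : State d) (g : Vec d) : State d :=
  let m : Vec d := β₁ • s.m + (1 - β₁) • g
  let v : Fin d → ℝ := fun i => β₂ * s.v i + (1 - β₂) * g i ^ 2
  let vhat : Fin d → ℝ := fun i => max (s.vhat i) (v i)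
  { x := mahalanobisProj X (fun i => √(vhat i))
      (s.x - α • WithLp.toLp 2 (fun i => m i / √(vhat i)))
    m := m
    v := v
    vhat := vhat }

/-- The ZO-AdaMM algorithm on the samples `ξ 0, ξ 1, …` and directions `u 0, u 1, …`.
Iterations are numbered from `0`: iteration `k` is the `(k+1)`-st one. `run … k` is the state when
iteration `k` starts, so that, for `t = k + 1`, its field `x` is `x_t`, the sample `ξ_t` is `ξ k`,
and the field `vhat` of `run … (k + 1)` is `v̂_t`. -/
def run {d : ℕ} {Ξ : Type*} (X : Set (Vec d)) (F : Vec d → Ξ → ℝ) (μ : ℝ) (α β₁ : ℕ → ℝ) (β₂ : ℝ)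
    (init : State d) (ξ : ℕ → Ξ) (u : ℕ → Vec d) : ℕ → State d
  | 0 => init
  | k + 1 =>
    let s := run X F μ α β₁ β₂ init ξ u k
    step X (α k) (β₁ k) β₂ s (zoGrad μ (fun y => F y (ξ k)) (u k) s.x)

/-- The convergence measure `‖G(x_t)‖² = ‖V̂_t^{1/4} P_{X, V̂_t^{1/2}}(x_t, ∇f(x_t), α)‖²` as a
function of `f`, `α`, `x_t` and `v̂_t`. -/
def measureG {d : ℕ} (X : Set (Vec d)) (f : Vec d → ℝ) (α : ℝ) (x : Vec d) (vhat : Fin d → ℝ) : ℝ :=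
  wsq (fun i => √(vhat i)) (gradMapping X (fun i => √(vhat i)) x (gradient f x) α)

end ZOAdaMM

end

/-! The argument is pathwise. Write φ = f_μ. The update is an exact proximal step along ĝ_t in the
metric V̂_t^{1/2} (`isProj_iff_isProx`), the same metric that measures G(x_t). Comparing it with the
proximal step along ∇φ(x_t) (`IsProx.model_le`) and using the descent inequality for φ, whose
quadratic term is absorbed because αL_g ≤ c, bounds the step along ∇φ(x_t) by the decrease φ(x_t) −
φ(x_{t+1}) plus the error ‖ĝ_t − ∇φ(x_t)‖². Stability of proximal steps replaces ∇φ by ∇f at the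
cost of the bias δ ≤ L_g μ d/2. This is `wsq_gradMapping_le`.

The decreases telescope. Neither unbiasedness of ĝ_t nor any conditioning enters, so the dependence
of V̂_t on ĝ_t is harmless. Averaging over R leaves 3D_f/(αT) + 3L_g²d/(4cT) + 3σ²/(2c), which is
below the claimed bound.

The remaining work is analytic: regularity of f and φ by differentiation under the integral, and
measurability of the iterates, obtained from continuity of the projection in both weights and point.
-/

namespace ZOAdaMM

/-! ### Weighted projections and proximal steps. -/

section Prox

variable {d : ℕ}

theorem mul_norm_sq_le_wsq {c : ℝ} {h : Fin d → ℝ} (hh : ∀ i, c ≤ h i) (z : Vec d) :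
    c * ‖z‖ ^ 2 ≤ wsq h z := by
  rw [EuclideanSpace.real_norm_sq_eq, Finset.mul_sum]
  exact Finset.sum_le_sum fun i _ => mul_le_mul_of_nonneg_right (hh i) (sq_nonneg _)

theorem wsq_smul (h : Fin d → ℝ) (t : ℝ) (z : Vec d) : wsq h (t • z) = t ^ 2 * wsq h z := by
  simp only [wsq, PiLp.smul_apply, smul_eq_mul, Finset.mul_sum]
  exact Finset.sum_congr rfl fun i _ => by ring

theorem inner_eq_sum (x y : Vec d) : inner ℝ x y = ∑ i, x i * y i := by
  simp [PiLp.inner_apply, mul_comm]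

theorem continuous_wsq : Continuous fun q : (Fin d → ℝ) × Vec d => wsq q.1 q.2 := by
  unfold wsq
  fun_prop

/-- Young's inequality for the norm weighted by `h ≥ c`. -/
theorem mul_inner_le_wsq_add {c : ℝ} (hc : 0 < c) {h : Fin d → ℝ} (hh : ∀ i, c ≤ h i)
    (α : ℝ) (a z : Vec d) :
    α * inner ℝ a z ≤ 1 / 2 * wsq h z + α ^ 2 / (2 * c) * ‖a‖ ^ 2 := by
  have h1 := mul_norm_sq_le_wsq hh z
  have h2 : 0 ≤ ‖(α / c) • a - z‖ ^ 2 := sq_nonneg _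
  rw [norm_sub_sq_real, norm_smul, inner_smul_left, mul_pow, Real.norm_eq_abs, sq_abs] at h2
  have h3 : α ^ 2 / (2 * c) * ‖a‖ ^ 2 = c / 2 * ((α / c) ^ 2 * ‖a‖ ^ 2) := by field_simp
  have h4 : α * inner ℝ a z = c / 2 * (2 * (α / c * inner ℝ a z)) := by field_simp
  have h5 : 0 ≤ c / 2 * ((α / c) ^ 2 * ‖a‖ ^ 2 - 2 * (α / c * inner ℝ a z) + ‖z‖ ^ 2) :=
    mul_nonneg (by positivity) (by simpa using h2)
  rw [h3, h4]
  linarith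

/-- `p` minimizes `⟨g, y⟩ + ‖H^{1/2} (y - xm)‖² / (2 w)` over `y ∈ X`. -/
def IsProx (X : Set (Vec d)) (h : Fin d → ℝ) (xm g : Vec d) (w : ℝ) (p : Vec d) : Prop :=
  p ∈ X ∧ ∀ y ∈ X,
    inner ℝ g p + 1 / w * (wsq h (p - xm) / 2) ≤ inner ℝ g y + 1 / w * (wsq h (y - xm) / 2)

/-- `p` minimizes `‖H^{1/2} (y - a)‖²` over `y ∈ X`. -/
def IsProj (X : Set (Vec d)) (h : Fin d → ℝ) (a p : Vec d) : Prop :=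
  p ∈ X ∧ ∀ y ∈ X, wsq h (p - a) ≤ wsq h (y - a)

/-- Completing the square: the two objectives differ by the factor 2w and a constant independent of
the competitor. -/
theorem isProj_iff_isProx {X : Set (Vec d)} {h : Fin d → ℝ} (hh : ∀ i, 0 < h i) {xm g : Vec d}
    {w : ℝ} (hw : 0 < w) {p : Vec d} :
    IsProj X h (xm - w • WithLp.toLp 2 (fun i => g i / h i)) p ↔ IsProx X h xm g w p := by
  have key : ∀ y : Vec d, wsq h (y - (xm - w • WithLp.toLp 2 (fun i => g i / h i))) =
      2 * w * (inner ℝ g y + 1 / w * (wsq h (y - xm) / 2)) +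
        ∑ i, (w ^ 2 * g i ^ 2 / h i - 2 * w * g i * xm i) := by
    intro y
    have : 2 * w * (inner ℝ g y + 1 / w * (wsq h (y - xm) / 2)) =
        2 * w * inner ℝ g y + wsq h (y - xm) := by field_simp
    rw [this, inner_eq_sum, wsq, wsq, Finset.mul_sum, ← Finset.sum_add_distrib,
      ← Finset.sum_add_distrib]
    refine Finset.sum_congr rfl fun i _ => ?_
    have := (hh i).ne'
    simp only [PiLp.sub_apply, PiLp.smul_apply, smul_eq_mul]
    field_simp
    ring
  refine and_congr_right fun _ => forall₂_congr fun y _ => ?_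
  rw [key, key, add_le_add_iff_right, mul_le_mul_iff_right₀ (by positivity)]

/-- A continuous coercive function attains its minimum on a closed set. Since the minimizers are
defined by `Classical.epsilon`, existence is what gives them their defining property. -/
theorem exists_isProj {X : Set (Vec d)} (hX : IsClosed X) (hne : X.Nonempty) {h : Fin d → ℝ}
    (hh : ∀ i, 0 < h i) (a : Vec d) : ∃ p, IsProj X h a p := by
  obtain ⟨x₀, hx₀⟩ := hne
  obtain ⟨c, hc, hch⟩ : ∃ c, 0 < c ∧ ∀ i, c ≤ h i := by
    rcases isEmpty_or_nonempty (Fin d) with he | he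
    · exact ⟨1, one_pos, fun i => he.elim i⟩
    · obtain ⟨i, hi⟩ := Finite.exists_min h
      exact ⟨h i, hh i, hi⟩
  have hcont : Continuous fun y : Vec d => wsq h (y - a) :=
    continuous_wsq.comp (continuous_const.prodMk (continuous_id.sub continuous_const))
  have ht : Filter.Tendsto (fun y : Vec d => wsq h (y - a)) (Filter.cocompact _) Filter.atTop := by
    refine Filter.tendsto_atTop_mono (fun y => mul_norm_sq_le_wsq hch (y - a)) ?_
    refine Filter.Tendsto.const_mul_atTop hc ?_
    refine (Filter.tendsto_pow_atTop two_ne_zero).comp ?_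
    refine Filter.tendsto_atTop_mono (fun y => norm_sub_norm_le y a) ?_
    exact Filter.tendsto_atTop_add_const_right _ _ (tendsto_norm_cocompact_atTop)
  obtain ⟨p, hp, hmin⟩ := hcont.continuousOn.exists_isMinOn' hX hx₀
    (Filter.Eventually.filter_mono inf_le_left (ht.eventually_ge_atTop _))
  exact ⟨p, hp, fun y hy => hmin hy⟩

theorem isProj_mahalanobisProj {X : Set (Vec d)} (hX : IsClosed X) (hne : X.Nonempty)
    {h : Fin d → ℝ} (hh : ∀ i, 0 < h i) (a : Vec d) : IsProj X h a (mahalanobisProj X h a) :=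
  Classical.epsilon_spec (exists_isProj hX hne hh a)

theorem isProx_proxPoint {X : Set (Vec d)} (hX : IsClosed X) (hne : X.Nonempty)
    {h : Fin d → ℝ} (hh : ∀ i, 0 < h i) (xm g : Vec d) {w : ℝ} (hw : 0 < w) :
    IsProx X h xm g w (proxPoint X h xm g w) := by
  obtain ⟨p, hp⟩ := exists_isProj hX hne hh (xm - w • WithLp.toLp 2 (fun i => g i / h i))
  exact Classical.epsilon_spec (p := IsProx X h xm g w) ⟨p, (isProj_iff_isProx hh hw).1 hp⟩

/-- First-order optimality of a proximal point. -/
theorem IsProx.variational {X : Set (Vec d)} (hX : Convex ℝ X) {h : Fin d → ℝ} {xm g : Vec d}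
    {w : ℝ} (hw : 0 < w) {p : Vec d} (hp : IsProx X h xm g w p) {y : Vec d} (hy : y ∈ X) :
    0 ≤ w * inner ℝ g (y - p) + ∑ i, h i * (p i - xm i) * (y i - p i) := by
  set A := w * inner ℝ g (y - p) + ∑ i, h i * (p i - xm i) * (y i - p i) with hA
  -- Compare p with p + t(y − p), divide by t, and let t → 0+ to remove the quadratic term.
  have key : ∀ t : ℝ, 0 < t → t ≤ 1 → 0 ≤ A + t * (wsq h (y - p) / 2) := by
    intro t ht ht1
    have hm := hp.2 (p + t • (y - p))
      (hX.add_smul_sub_mem hp.1 hy ⟨ht.le, ht1⟩)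
    have e1 : wsq h (p + t • (y - p) - xm) = wsq h (p - xm) +
        2 * t * (∑ i, h i * (p i - xm i) * (y i - p i)) + t ^ 2 * wsq h (y - p) := by
      simp only [wsq, Finset.mul_sum, ← Finset.sum_add_distrib]
      refine Finset.sum_congr rfl fun i _ => ?_
      simp only [PiLp.sub_apply, PiLp.add_apply, PiLp.smul_apply, smul_eq_mul]
      ring
    rw [e1, inner_add_right, inner_smul_right] at hm
    have h2 := mul_le_mul_of_nonneg_left hm hw.le
    have e2 : ∀ s q : ℝ, w * (s + 1 / w * q) = w * s + q := fun s q => by field_simp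
    rw [e2, e2] at h2
    have h3 : 0 ≤ t * (A + t * (wsq h (y - p) / 2)) := by rw [hA]; nlinarith
    exact nonneg_of_mul_nonneg_right h3 ht
  have hlim : Filter.Tendsto (fun t : ℝ => A + t * (wsq h (y - p) / 2))
      (nhdsWithin 0 (Set.Ioi 0)) (nhds A) := by
    have : Continuous fun t : ℝ => A + t * (wsq h (y - p) / 2) := by fun_prop
    simpa using (this.tendsto 0).mono_left nhdsWithin_le_nhds
  refine ge_of_tendsto hlim ?_
  filter_upwards [Ioc_mem_nhdsGT (zero_lt_one' ℝ)] with t ht using key t ht.1 ht.2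

theorem IsProj.variational {X : Set (Vec d)} (hX : Convex ℝ X) {h : Fin d → ℝ} {a p : Vec d}
    (hp : IsProj X h a p) {y : Vec d} (hy : y ∈ X) :
    0 ≤ ∑ i, h i * (p i - a i) * (y i - p i) := by
  have h1 : IsProx X h a 0 1 p := ⟨hp.1, fun z hz => by simpa [div_le_div_iff_of_pos_right] using hp.2 z hz⟩
  simpa using h1.variational hX one_pos hy

/-- The Mahalanobis projection depends on the weights and on the point in a locally Lipschitz
way. -/
theorem IsProj.norm_sub_le {X : Set (Vec d)} (hX : Convex ℝ X) {c : ℝ} {h h' : Fin d → ℝ}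
    (hh : ∀ i, c ≤ h i) {a a' p p' : Vec d} (hp : IsProj X h a p) (hp' : IsProj X h' a' p') :
    c * ‖p - p'‖ ≤
      ‖(WithLp.toLp 2 fun i => h i * a i - h' i * a' i - (h i - h' i) * p' i : Vec d)‖ := by
  set z : Vec d := WithLp.toLp 2 fun i => h i * a i - h' i * a' i - (h i - h' i) * p' i with hz
  have h1 := hp.variational hX hp'.1
  have h2 := hp'.variational hX hp.1
  -- Sum of the two variational inequalities, each tested at the other point.
  have h3 : wsq h (p - p') ≤ inner ℝ z (p - p') := by
    have : inner ℝ z (p - p') - wsq h (p - p') = (∑ i, h i * (p i - a i) * (p' i - p i)) +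
        ∑ i, h' i * (p' i - a' i) * (p i - p' i) := by
      simp only [inner_eq_sum, wsq, ← Finset.sum_add_distrib, ← Finset.sum_sub_distrib]
      refine Finset.sum_congr rfl fun i _ => ?_
      simp only [hz, PiLp.sub_apply]
      ring
    linarith
  have h4 := mul_norm_sq_le_wsq hh (p - p')
  have h5 := real_inner_le_norm z (p - p')
  rcases (norm_nonneg (p - p')).eq_or_lt with h0 | h0
  · rw [← h0]; simp
  · refine le_of_mul_le_mul_right ?_ h0
    nlinarith

/-- Truncating the weights at c makes the projection well behaved on the whole space; weights
already above c are unaffected. This is the source of measurability for the iterates. -/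
theorem continuous_mahalanobisProj {X : Set (Vec d)} (hXc : IsClosed X) (hX : Convex ℝ X)
    (hne : X.Nonempty) {c : ℝ} (hc : 0 < c) :
    Continuous fun q : (Fin d → ℝ) × Vec d => mahalanobisProj X (fun i => max c (q.1 i)) q.2 := by
  have hpr : ∀ q : (Fin d → ℝ) × Vec d, IsProj X (fun i => max c (q.1 i)) q.2
      (mahalanobisProj X (fun i => max c (q.1 i)) q.2) := fun q =>
    isProj_mahalanobisProj hXc hne (fun i => hc.trans_le (le_max_left _ _)) _
  rw [continuous_iff_continuousAt]
  intro q₀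
  set p₀ := mahalanobisProj X (fun i => max c (q₀.1 i)) q₀.2 with hp₀
  rw [ContinuousAt, tendsto_iff_norm_sub_tendsto_zero]
  let ψ : (Fin d → ℝ) × Vec d → Vec d := fun q => WithLp.toLp 2 fun i =>
    max c (q.1 i) * q.2 i - max c (q₀.1 i) * q₀.2 i - (max c (q.1 i) - max c (q₀.1 i)) * p₀ i
  have hψ : Continuous ψ := by
    refine (PiLp.continuous_toLp 2 _).comp (continuous_pi fun i => ?_)
    fun_prop
  have hψ0 : ψ q₀ = 0 := by ext i; simp [ψ]
  refine squeeze_zero (g := fun q => c⁻¹ * ‖ψ q‖) (fun _ => norm_nonneg _) (fun q => ?_) ?_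
  · rw [le_inv_mul_iff₀ hc]
    exact (hpr q).norm_sub_le hX (fun i => le_max_left _ _) (hpr q₀)
  · have : Continuous fun q => c⁻¹ * ‖ψ q‖ := by fun_prop
    simpa only [hψ0, norm_zero, mul_zero] using this.tendsto q₀

theorem IsProx.wsq_sub_le {X : Set (Vec d)} (hX : Convex ℝ X) {c : ℝ} (hc : 0 < c)
    {h : Fin d → ℝ} (hh : ∀ i, c ≤ h i) {x g p : Vec d} {w : ℝ} (hw : 0 < w) (hx : x ∈ X)
    (hp : IsProx X h x g w p) : wsq h (x - p) ≤ w ^ 2 / c * ‖g‖ ^ 2 := by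
  have h1 := hp.variational hX hw hx
  have h2 := mul_inner_le_wsq_add hc hh w g (x - p)
  have h3 : ∑ i, h i * (p i - x i) * (x i - p i) = - wsq h (x - p) := by
    rw [wsq, ← Finset.sum_neg_distrib]
    exact Finset.sum_congr rfl fun i _ => by simp only [PiLp.sub_apply]; ring
  have h4 : w ^ 2 / c * ‖g‖ ^ 2 = 2 * (w ^ 2 / (2 * c) * ‖g‖ ^ 2) := by field_simp
  linarith

/-- Add the two variational inequalities, each tested at the other minimizer; Young's inequality
then absorbs half of the weighted square. -/
theorem IsProx.wsq_sub_prox_le {X : Set (Vec d)} (hX : Convex ℝ X) {c : ℝ} (hc : 0 < c)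
    {h : Fin d → ℝ} (hh : ∀ i, c ≤ h i) {x a b p q : Vec d} {w : ℝ} (hw : 0 < w)
    (hp : IsProx X h x a w p) (hq : IsProx X h x b w q) :
    wsq h (p - q) ≤ w ^ 2 / c * ‖a - b‖ ^ 2 := by
  have h1 := hp.variational hX hw hq.1
  have h2 := hq.variational hX hw hp.1
  have h3 : (∑ i, h i * (p i - x i) * (q i - p i)) + ∑ i, h i * (q i - x i) * (p i - q i) =
      - wsq h (p - q) := by
    rw [wsq, ← Finset.sum_neg_distrib, ← Finset.sum_add_distrib]
    exact Finset.sum_congr rfl fun i _ => by simp only [PiLp.sub_apply]; ring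
  have h4 : inner ℝ (b - a) (p - q) = inner ℝ a (q - p) + inner ℝ b (p - q) := by
    simp only [inner_sub_left, inner_sub_right]; ring
  have h5 := mul_inner_le_wsq_add hc hh w (b - a) (p - q)
  rw [h4, norm_sub_rev b a] at h5
  have h6 : w ^ 2 / c * ‖a - b‖ ^ 2 = 2 * (w ^ 2 / (2 * c) * ‖a - b‖ ^ 2) := by field_simp
  linarith

/-- The exact proximal steps along `a` and `b` have comparable lengths. -/
theorem IsProx.wsq_sub_le_of_prox {X : Set (Vec d)} (hX : Convex ℝ X) {c : ℝ} (hc : 0 < c)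
    {h : Fin d → ℝ} (hh : ∀ i, c ≤ h i) {x a b p q : Vec d} {w : ℝ} (hw : 0 < w)
    (hp : IsProx X h x a w p) (hq : IsProx X h x b w q) :
    wsq h (x - p) ≤ 3 / 2 * wsq h (x - q) + 3 * (w ^ 2 / c * ‖a - b‖ ^ 2) := by
  have h1 := hp.wsq_sub_prox_le hX hc hh hw hq
  -- The split (a − b)² ≤ (3/2)a² + 3b² has slack (a + 2b)²/2. The factor 3 is what makes the final
  -- bias term exactly 3L_g²d/(4cT).
  have h2 : wsq h (x - p) ≤ 3 / 2 * wsq h (x - q) + 3 * wsq h (p - q) := by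
    simp only [wsq, Finset.mul_sum, ← Finset.sum_add_distrib]
    refine Finset.sum_le_sum fun i _ => ?_
    simp only [PiLp.sub_apply]
    have := mul_nonneg (hc.le.trans (hh i)) (sq_nonneg ((x i - q i) + 2 * (p i - q i)))
    nlinarith
  linarith

/-- A proximal step along `g` decreases the quadratic model with linear part `b`, up to the error
`g - b`. -/
theorem IsProx.model_le {X : Set (Vec d)} (hX : Convex ℝ X) {c : ℝ} (hc : 0 < c)
    {h : Fin d → ℝ} (hh : ∀ i, c ≤ h i) {x g b p q : Vec d} {w : ℝ} (hw : 0 < w) (hx : x ∈ X)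
    (hp : IsProx X h x g w p) (hq : IsProx X h x b w q) :
    w * inner ℝ b (p - x) + 1 / 2 * wsq h (p - x) ≤
      - (1 / 2 * wsq h (x - q)) + w ^ 2 / (2 * c) * ‖g - b‖ ^ 2 := by
  have h1 := hp.variational hX hw hq.1
  have h2 := hq.variational hX hw hx
  have h3 := mul_inner_le_wsq_add hc hh w (g - b) (q - p)
  -- Three-point identity; its term −½‖q − p‖² in the weighted norm cancels the one produced by
  -- Young's inequality in `h3`.
  have h4 : (∑ i, h i * (p i - x i) * (q i - p i)) + 1 / 2 * wsq h (p - x) =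
      1 / 2 * wsq h (x - q) - 1 / 2 * wsq h (q - p) := by
    simp only [wsq, Finset.mul_sum, ← Finset.sum_add_distrib, ← Finset.sum_sub_distrib]
    exact Finset.sum_congr rfl fun i _ => by simp only [PiLp.sub_apply]; ring
  have h5 : ∑ i, h i * (q i - x i) * (x i - q i) = - wsq h (x - q) := by
    rw [wsq, ← Finset.sum_neg_distrib]
    exact Finset.sum_congr rfl fun i _ => by simp only [PiLp.sub_apply]; ring
  simp only [inner_sub_left, inner_sub_right] at h1 h2 h3 ⊢
  nlinarith

end Prox

/-! ### Functions with Lipschitz gradient. -/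

section Smooth

variable {d : ℕ}

theorem fderiv_apply_eq_inner (f : Vec d → ℝ) (x v : Vec d) :
    fderiv ℝ f x v = inner ℝ (gradient f x) v := by
  simp [gradient]

theorem norm_gradient (f : Vec d → ℝ) (x : Vec d) : ‖gradient f x‖ = ‖fderiv ℝ f x‖ := by
  simp [gradient]

theorem norm_gradient_sub (f g : Vec d → ℝ) (x y : Vec d) :
    ‖gradient f x - gradient g y‖ = ‖fderiv ℝ f x - fderiv ℝ g y‖ := by
  simp [gradient, ← map_sub]

/-- The quadratic upper bound for functions with Lipschitz gradient. -/
theorem le_add_inner_add_norm_sq {f : Vec d → ℝ} (hf : Differentiable ℝ f) {L : ℝ}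
    (hL : ∀ x y, ‖gradient f x - gradient f y‖ ≤ L * ‖x - y‖) (x y : Vec d) :
    f y ≤ f x + inner ℝ (gradient f x) (y - x) + L / 2 * ‖y - x‖ ^ 2 := by
  set v := y - x with hv
  -- The function along the segment minus its quadratic model; the Lipschitz bound makes it
  -- nonincreasing on [0, 1].
  let φ : ℝ → ℝ := fun t => f (x + t • v) - t * inner ℝ (gradient f x) v - t ^ 2 * (L / 2 * ‖v‖ ^ 2)
  have hφ : ∀ t, HasDerivAt φ (inner ℝ (gradient f (x + t • v)) v - inner ℝ (gradient f x) v
      - 2 * t * (L / 2 * ‖v‖ ^ 2)) t := by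
    intro t
    have h1 : HasDerivAt (fun t : ℝ => x + t • v) v t := by
      simpa using ((hasDerivAt_id t).smul_const v).const_add x
    have h2 := (hf (x + t • v)).hasFDerivAt.comp_hasDerivAt t h1
    rw [fderiv_apply_eq_inner] at h2
    have h3 := (hasDerivAt_id t).mul_const (inner ℝ (gradient f x) v)
    have h4 := (hasDerivAt_pow 2 t).mul_const (L / 2 * ‖v‖ ^ 2)
    refine ((h2.sub h3).sub h4).congr_deriv ?_
    norm_num
  have hanti : AntitoneOn φ (Set.Icc 0 1) := by
    refine antitoneOn_of_deriv_nonpos (convex_Icc 0 1)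
      (fun t _ => (hφ t).continuousAt.continuousWithinAt)
      (fun t _ => (hφ t).differentiableAt.differentiableWithinAt) fun t ht => ?_
    rw [interior_Icc] at ht
    rw [(hφ t).deriv, ← inner_sub_left]
    have h1 := real_inner_le_norm (gradient f (x + t • v) - gradient f x) v
    have h2 := hL (x + t • v) x
    rw [add_sub_cancel_left, norm_smul, Real.norm_of_nonneg ht.1.le] at h2
    have h3 := mul_le_mul_of_nonneg_right h2 (norm_nonneg v)
    nlinarith
  have := hanti (Set.left_mem_Icc.2 zero_le_one) (Set.right_mem_Icc.2 zero_le_one) zero_le_one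
  simp only [φ, one_smul, zero_smul, add_zero] at this
  have e : x + v = y := by simp [hv]
  rw [e] at this
  linarith

end Smooth

/-! ### Differentiation under the expectation. -/

section Parametric

variable {d : ℕ} {Ξ : Type*} [MeasurableSpace Ξ] {P : Measure Ξ} {F : Vec d → Ξ → ℝ}

/-- Each directional derivative is a pointwise limit of measurable difference quotients; the
coordinate directions give the gradient, and the Riesz isometry the derivative. -/
theorem measurable_fderiv_param (hFm : ∀ x, Measurable (F x))
    (hdiff : ∀ s, Differentiable ℝ (fun x => F x s)) (x : Vec d) :
    Measurable fun s => fderiv ℝ (fun z => F z s) x := by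
  have happ : ∀ v, Measurable fun s => fderiv ℝ (fun z => F z s) x v := by
    intro v
    refine measurable_of_tendsto_metrizable
      (f := fun (n : ℕ) s => (n : ℝ) • (F (x + (n : ℝ)⁻¹ • v) s - F x s)) (fun n => ?_) ?_
    · exact ((hFm _).sub (hFm _)).const_mul (n : ℝ)
    · rw [tendsto_pi_nhds]
      exact fun s => ((hdiff s x).hasFDerivAt.lim_real v).comp tendsto_natCast_atTop_atTop
  have hgrad : Measurable fun s => gradient (fun z => F z s) x := by
    have : (fun s => gradient (fun z => F z s) x) = fun s => WithLp.toLp 2 fun i =>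
        fderiv ℝ (fun z => F z s) x (EuclideanSpace.single i 1) := by
      ext s i
      change _ = fderiv ℝ (fun z => F z s) x (EuclideanSpace.single i 1)
      rw [fderiv_apply_eq_inner, EuclideanSpace.inner_single_right]
      simp only [one_mul, conj_trivial]
    rw [this]
    exact (WithLp.measurable_toLp 2 _).comp (measurable_pi_lambda _ fun i => happ _)
  have : (fun s => fderiv ℝ (fun z => F z s) x) = fun s =>
      InnerProductSpace.toDual ℝ (Vec d) (gradient (fun z => F z s) x) := by
    ext s; simp [gradient]
  rw [this]
  exact (InnerProductSpace.toDual ℝ (Vec d)).continuous.measurable.comp hgrad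

variable [IsProbabilityMeasure P]

theorem integrable_fderiv_param (hFm : ∀ x, Measurable (F x))
    (hdiff : ∀ s, Differentiable ℝ (fun x => F x s)) {B : ℝ}
    (hB : ∀ s x, ‖fderiv ℝ (fun z => F z s) x‖ ≤ B) (x : Vec d) :
    Integrable (fun s => fderiv ℝ (fun z => F z s) x) P :=
  Integrable.of_bound (measurable_fderiv_param hFm hdiff x).aestronglyMeasurable B
    (Filter.Eventually.of_forall fun s => hB s x)

theorem hasFDerivAt_objective (hFm : ∀ x, Measurable (F x)) (hFint : ∀ x, Integrable (F x) P)
    (hdiff : ∀ s, Differentiable ℝ (fun x => F x s)) {B : ℝ}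
    (hB : ∀ s x, ‖fderiv ℝ (fun z => F z s) x‖ ≤ B) (x : Vec d) :
    HasFDerivAt (objective P F) (∫ s, fderiv ℝ (fun z => F z s) x ∂P) x :=
  hasFDerivAt_integral_of_dominated_of_fderiv_le (bound := fun _ => B)
    (F' := fun x s => fderiv ℝ (fun z => F z s) x) Filter.univ_mem
    (Filter.Eventually.of_forall fun x => (hFm x).aestronglyMeasurable) (hFint x)
    (measurable_fderiv_param hFm hdiff x).aestronglyMeasurable
    (Filter.Eventually.of_forall fun s x _ => hB s x) (integrable_const B)
    (Filter.Eventually.of_forall fun s x _ => (hdiff s x).hasFDerivAt)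

theorem norm_fderiv_objective_le (hFm : ∀ x, Measurable (F x)) (hFint : ∀ x, Integrable (F x) P)
    (hdiff : ∀ s, Differentiable ℝ (fun x => F x s)) {B : ℝ}
    (hB : ∀ s x, ‖fderiv ℝ (fun z => F z s) x‖ ≤ B) (x : Vec d) :
    ‖fderiv ℝ (objective P F) x‖ ≤ B := by
  rw [(hasFDerivAt_objective hFm hFint hdiff hB x).fderiv]
  simpa using norm_integral_le_of_norm_le_const (μ := P)
    (Filter.Eventually.of_forall fun s => hB s x)

theorem norm_fderiv_objective_sub_le (hFm : ∀ x, Measurable (F x))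
    (hFint : ∀ x, Integrable (F x) P)
    (hdiff : ∀ s, Differentiable ℝ (fun x => F x s)) {B L : ℝ}
    (hB : ∀ s x, ‖fderiv ℝ (fun z => F z s) x‖ ≤ B)
    (hL : ∀ s x y, ‖fderiv ℝ (fun z => F z s) x - fderiv ℝ (fun z => F z s) y‖ ≤ L * ‖x - y‖)
    (x y : Vec d) :
    ‖fderiv ℝ (objective P F) x - fderiv ℝ (objective P F) y‖ ≤ L * ‖x - y‖ := by
  rw [(hasFDerivAt_objective hFm hFint hdiff hB x).fderiv,
    (hasFDerivAt_objective hFm hFint hdiff hB y).fderiv,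
    ← integral_sub (integrable_fderiv_param hFm hdiff hB x)
      (integrable_fderiv_param hFm hdiff hB y)]
  simpa using norm_integral_le_of_norm_le_const (μ := P)
    (Filter.Eventually.of_forall fun s => hL s x y)

end Parametric

/-! ### Smoothing over the unit ball. -/

section Smoothing

variable {d : ℕ}

/-- The uniform distribution on the unit ball of `ℝ^d`. -/
noncomputable def uniformBall (d : ℕ) : Measure (Vec d) :=
  (volume : Measure (Vec d))[|Metric.ball 0 1]

instance : IsProbabilityMeasure (uniformBall d) :=
  cond_isProbabilityMeasure_of_finite (Metric.measure_ball_pos _ _ one_pos).ne' measure_ball_lt_top.ne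

theorem integral_uniformBall {E : Type*} [NormedAddCommGroup E] [NormedSpace ℝ E] (f : Vec d → E) :
    ∫ w, f w ∂uniformBall d = ⨍ w in Metric.ball (0 : Vec d) 1, f w := by
  rw [setAverage_eq, uniformBall, ProbabilityTheory.cond, integral_smul_measure,
    ENNReal.toReal_inv, measureReal_def]

/-- Smoothing is an expectation with the ball as sample space, so the parametric differentiation
lemma applies to it. -/
theorem smoothing_eq_objective (μ : ℝ) (f : Vec d → ℝ) :
    smoothing μ f = objective (uniformBall d) fun x w => f (x + μ • w) := by
  ext x
  rw [objective, integral_uniformBall, smoothing]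

theorem ae_norm_le_one_uniformBall : ∀ᵐ w ∂uniformBall d, ‖w‖ ≤ 1 := by
  have h : ∀ᵐ w ∂(volume : Measure (Vec d)).restrict (Metric.ball 0 1), ‖w‖ ≤ 1 := by
    filter_upwards [ae_restrict_mem measurableSet_ball] with w hw
    exact (mem_ball_zero_iff.1 hw).le
  exact Measure.ae_smul_measure h _

theorem integrable_uniformBall {E : Type*} [NormedAddCommGroup E] {f : Vec d → E}
    (hf : Continuous f) : Integrable f (uniformBall d) := by
  obtain ⟨C, hC⟩ := (isCompact_closedBall (0 : Vec d) 1).exists_bound_of_continuousOn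
    hf.continuousOn
  refine Integrable.of_bound hf.aestronglyMeasurable C ?_
  filter_upwards [ae_norm_le_one_uniformBall] with w hw
  exact hC w (by simpa using hw)

/-- Polar coordinates. The exact mean matters for the bias bound when d = 1, where ‖w‖ ≤ 1 alone
would lose a factor 2. -/
theorem integral_norm_uniformBall (hd : 0 < d) :
    ∫ w, ‖w‖ ∂uniformBall d = (d : ℝ) / (d + 1) := by
  have : Nonempty (Fin d) := ⟨⟨0, hd⟩⟩
  have hv : volume.real (Metric.ball (0 : Vec d) 1) ≠ 0 := by
    rw [measureReal_def, ENNReal.toReal_ne_zero]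
    exact ⟨(Metric.measure_ball_pos _ _ one_pos).ne', measure_ball_lt_top.ne⟩
  have h1 : ∫ w in Metric.ball (0 : Vec d) 1, ‖w‖ =
      ∫ w : Vec d, (Set.Iio (1 : ℝ)).indicator id ‖w‖ := by
    rw [← integral_indicator measurableSet_ball]
    congr 1 with w
    by_cases hw : ‖w‖ < 1 <;> simp [hw]
  have h2 : ∫ y in Set.Ioi (0 : ℝ), y ^ (d - 1) • (Set.Iio (1 : ℝ)).indicator id y =
      1 / ((d : ℝ) + 1) := by
    have : ∀ y : ℝ, y ^ (d - 1) • (Set.Iio (1 : ℝ)).indicator id y =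
        (Set.Iio (1 : ℝ)).indicator (fun y => y ^ d) y := by
      intro y
      by_cases hy : y < 1
      · simp [hy, pow_sub_one_mul hd.ne']
      · simp [hy]
    simp_rw [this]
    rw [setIntegral_indicator measurableSet_Iio, Set.Ioi_inter_Iio, ← integral_Ioc_eq_integral_Ioo,
      ← intervalIntegral.integral_of_le zero_le_one, integral_pow]
    simp
  rw [integral_uniformBall, setAverage_eq, h1, integral_fun_norm_addHaar,
    finrank_euclideanSpace_fin, h2, nsmul_eq_mul, smul_eq_mul, smul_eq_mul]
  field_simp

variable {f : Vec d → ℝ}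

theorem fderiv_comp_add_const (f : Vec d → ℝ) (a x : Vec d) :
    fderiv ℝ (fun z => f (z + a)) x = fderiv ℝ f (x + a) :=
  fderiv_comp_add_right a

theorem continuous_fderiv_of_lipschitz {L : ℝ}
    (hL : ∀ x y, ‖fderiv ℝ f x - fderiv ℝ f y‖ ≤ L * ‖x - y‖) : Continuous (fderiv ℝ f) := by
  refine LipschitzWith.continuous (K := L.toNNReal) (LipschitzWith.of_dist_le_mul fun x y => ?_)
  rw [dist_eq_norm, dist_eq_norm]
  exact (hL x y).trans (mul_le_mul_of_nonneg_right (Real.le_coe_toNNReal L) (norm_nonneg _))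

theorem hasFDerivAt_smoothing (hf : Differentiable ℝ f) {B : ℝ}
    (hB : ∀ x, ‖fderiv ℝ f x‖ ≤ B) (μ : ℝ) (x : Vec d) :
    HasFDerivAt (smoothing μ f) (∫ w, fderiv ℝ f (x + μ • w) ∂uniformBall d) x := by
  have hc := hf.continuous
  have := hasFDerivAt_objective (P := uniformBall d) (F := fun x w => f (x + μ • w)) (B := B)
    (fun x => Continuous.measurable (by fun_prop))
    (fun x => integrable_uniformBall (by fun_prop)) (fun w => by fun_prop)
    (fun w x => by rw [fderiv_comp_add_const]; exact hB _) x
  simp_rw [fderiv_comp_add_const] at this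
  rwa [smoothing_eq_objective]

theorem norm_fderiv_smoothing_le (hf : Differentiable ℝ f) {B : ℝ}
    (hB : ∀ x, ‖fderiv ℝ f x‖ ≤ B) (μ : ℝ) (x : Vec d) : ‖fderiv ℝ (smoothing μ f) x‖ ≤ B := by
  rw [(hasFDerivAt_smoothing hf hB μ x).fderiv]
  simpa using norm_integral_le_of_norm_le_const (μ := uniformBall d)
    (Filter.Eventually.of_forall fun w => hB (x + μ • w))

theorem norm_fderiv_smoothing_sub_le (hf : Differentiable ℝ f) {B L : ℝ}
    (hB : ∀ x, ‖fderiv ℝ f x‖ ≤ B)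
    (hL : ∀ x y, ‖fderiv ℝ f x - fderiv ℝ f y‖ ≤ L * ‖x - y‖) (μ : ℝ) (x y : Vec d) :
    ‖fderiv ℝ (smoothing μ f) x - fderiv ℝ (smoothing μ f) y‖ ≤ L * ‖x - y‖ := by
  have hc := continuous_fderiv_of_lipschitz hL
  rw [(hasFDerivAt_smoothing hf hB μ x).fderiv, (hasFDerivAt_smoothing hf hB μ y).fderiv,
    ← integral_sub (integrable_uniformBall (by fun_prop)) (integrable_uniformBall (by fun_prop))]
  simpa using norm_integral_le_of_norm_le_const (μ := uniformBall d)
    (Filter.Eventually.of_forall fun w => by simpa using hL (x + μ • w) (y + μ • w))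

theorem norm_fderiv_sub_fderiv_smoothing_le (hd : 0 < d) (hf : Differentiable ℝ f) {B L μ : ℝ}
    (hμ : 0 ≤ μ) (hL0 : 0 ≤ L) (hB : ∀ x, ‖fderiv ℝ f x‖ ≤ B)
    (hL : ∀ x y, ‖fderiv ℝ f x - fderiv ℝ f y‖ ≤ L * ‖x - y‖) (x : Vec d) :
    ‖fderiv ℝ f x - fderiv ℝ (smoothing μ f) x‖ ≤ L * μ * d / 2 := by
  have hc := continuous_fderiv_of_lipschitz hL
  have h1 : ‖fderiv ℝ f x - fderiv ℝ (smoothing μ f) x‖ ≤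
      ∫ w, L * μ * ‖w‖ ∂uniformBall d := by
    have : fderiv ℝ f x - fderiv ℝ (smoothing μ f) x =
        ∫ w, (fderiv ℝ f x - fderiv ℝ f (x + μ • w)) ∂uniformBall d := by
      rw [integral_sub (integrable_const _) (integrable_uniformBall (by fun_prop)),
        (hasFDerivAt_smoothing hf hB μ x).fderiv]
      simp
    rw [this]
    refine norm_integral_le_of_norm_le (integrable_uniformBall (by fun_prop))
      (Filter.Eventually.of_forall fun w => (hL _ _).trans ?_)
    simp [norm_smul, abs_of_nonneg hμ, mul_assoc]
  rw [integral_const_mul, integral_norm_uniformBall hd] at h1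
  refine h1.trans ?_
  rw [mul_div_assoc]
  -- Here d/(d + 1) ≤ d/2, because d ≥ 1.
  have hd1 : (1 : ℝ) ≤ d := by exact_mod_cast hd
  gcongr
  linarith

end Smoothing

/-! ### One-step estimates. -/

section Deterministic

variable {d : ℕ}

/-- One step of the proximal method: the gradient mapping of `f` is controlled by the decrease of
the surrogate `φ`, the error of `g`, and the bias `δ` of `∇ φ`. -/
theorem wsq_gradMapping_le {X : Set (Vec d)} (hXc : IsClosed X) (hX : Convex ℝ X)
    {c α L δ : ℝ} (hc : 0 < c) (hα : 0 < α) (hαL : α * L ≤ c) {h : Fin d → ℝ}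
    (hh : ∀ i, c ≤ h i) {φ : Vec d → ℝ} (hφ : Differentiable ℝ φ)
    (hL : ∀ x y, ‖gradient φ x - gradient φ y‖ ≤ L * ‖x - y‖) {x x' a g : Vec d} (hx : x ∈ X)
    (hδ : ‖a - gradient φ x‖ ≤ δ) (hx' : IsProx X h x g α x') :
    wsq h (gradMapping X h x a α) ≤
      3 / α * (φ x - φ x') + 3 / (2 * c) * ‖g - gradient φ x‖ ^ 2 + 3 / c * δ ^ 2 := by
  have hh0 : ∀ i, 0 < h i := fun i => hc.trans_le (hh i)
  have hp := isProx_proxPoint hXc ⟨x, hx⟩ hh0 x a hα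
  have hq := isProx_proxPoint hXc ⟨x, hx⟩ hh0 x (gradient φ x) hα
  rw [gradMapping, wsq_smul]
  set p := proxPoint X h x a α
  set q := proxPoint X h x (gradient φ x) α
  set b := gradient φ x
  have h1 := hp.wsq_sub_le_of_prox hX hc hh hα hq
  have h2 := hx'.model_le hX hc hh hα hx hq
  have h3 := mul_le_mul_of_nonneg_left (le_add_inner_add_norm_sq hφ hL x x') hα.le
  have h4 := mul_norm_sq_le_wsq hh (x' - x)
  have h5 : α * L * ‖x' - x‖ ^ 2 ≤ c * ‖x' - x‖ ^ 2 :=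
    mul_le_mul_of_nonneg_right hαL (sq_nonneg _)
  have h6 : ‖a - b‖ ^ 2 ≤ δ ^ 2 := pow_le_pow_left₀ (norm_nonneg _) hδ 2
  -- The smoothness term (αL/2)‖x' − x‖² is absorbed by the quadratic part of the proximal model,
  -- since αL ≤ c ≤ h.
  have h7 : 1 / 2 * wsq h (x - q) ≤ α * (φ x - φ x') + α ^ 2 / (2 * c) * ‖g - b‖ ^ 2 := by
    simp only [b] at h2 ⊢
    linarith
  have h8 : α ^ 2 / c * ‖a - b‖ ^ 2 ≤ α ^ 2 / c * δ ^ 2 :=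
    mul_le_mul_of_nonneg_left h6 (by positivity)
  have h9 : wsq h (x - p) ≤ α ^ 2 * (3 / α * (φ x - φ x') + 3 / (2 * c) * ‖g - b‖ ^ 2
      + 3 / c * δ ^ 2) := by
    have e : α ^ 2 * (3 / α * (φ x - φ x') + 3 / (2 * c) * ‖g - b‖ ^ 2 + 3 / c * δ ^ 2) =
        3 * (α * (φ x - φ x') + α ^ 2 / (2 * c) * ‖g - b‖ ^ 2) + 3 * (α ^ 2 / c * δ ^ 2) := by
      field_simp
    rw [e]
    linarith
  rw [inv_pow, inv_mul_le_iff₀ (by positivity)]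
  exact h9

/-- A bound uniform over the random weights, used for integrability of the convergence measure. -/
theorem wsq_gradMapping_le_norm_sq {X : Set (Vec d)} (hXc : IsClosed X) (hX : Convex ℝ X)
    {c α : ℝ} (hc : 0 < c) (hα : 0 < α) {h : Fin d → ℝ} (hh : ∀ i, c ≤ h i) {x : Vec d}
    (hx : x ∈ X) (a : Vec d) : wsq h (gradMapping X h x a α) ≤ ‖a‖ ^ 2 / c := by
  have hp := isProx_proxPoint hXc ⟨x, hx⟩ (fun i => hc.trans_le (hh i)) x a hα
  rw [gradMapping, wsq_smul, inv_pow, inv_mul_le_iff₀ (by positivity)]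
  refine (hp.wsq_sub_le hX hc hh hα hx).trans_eq ?_
  ring

/-- The two defining predicates coincide, so `Classical.epsilon` picks the same point and uniqueness
is not needed. Measurability of the projection thus passes to the proximal point. -/
theorem proxPoint_eq_mahalanobisProj (X : Set (Vec d)) {h : Fin d → ℝ} (hh : ∀ i, 0 < h i)
    (xm g : Vec d) {w : ℝ} (hw : 0 < w) :
    proxPoint X h xm g w =
      mahalanobisProj X h (xm - w • WithLp.toLp 2 (fun i => g i / h i)) := by
  have : IsProx X h xm g w = IsProj X h (xm - w • WithLp.toLp 2 (fun i => g i / h i)) :=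
    funext fun p => propext (isProj_iff_isProx hh hw).symm
  exact congrArg Classical.epsilon this

theorem norm_zoGrad_le {f : Vec d → ℝ} (hf : Differentiable ℝ f) {B : ℝ}
    (hB : ∀ x, ‖fderiv ℝ f x‖ ≤ B) {μ : ℝ} (hμ : 0 < μ) {u : Vec d} (hu : ‖u‖ = 1) (x : Vec d) :
    ‖zoGrad μ f u x‖ ≤ d * B := by
  have h1 := convex_univ.norm_image_sub_le_of_norm_fderiv_le (𝕜 := ℝ) (f := f) (C := B)
    (x := x) (y := x + μ • u) (fun x _ => hf x) (fun x _ => hB x) (Set.mem_univ _) (Set.mem_univ _)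
  rw [add_sub_cancel_left, norm_smul, hu, mul_one, Real.norm_of_nonneg hμ.le] at h1
  rw [zoGrad, norm_smul, hu, mul_one, norm_mul, Real.norm_of_nonneg (by positivity)]
  calc (d : ℝ) / μ * ‖f (x + μ • u) - f x‖ ≤ d / μ * (B * μ) := by gcongr
    _ = d * B := by field_simp

end Deterministic

/-! ### Invariants of the iteration. -/

section Run

variable {d : ℕ} {Ξ : Type*} {X : Set (Vec d)} {F : Vec d → Ξ → ℝ} {μ α β₂ c : ℝ}
  {init : State d}

theorem le_sqrt_vhat_run (hv₀ : ∀ i, c ≤ √(init.vhat i)) (α β₁ : ℕ → ℝ) (ξ : ℕ → Ξ)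
    (u : ℕ → Vec d) (k : ℕ) (i : Fin d) :
    c ≤ √((run X F μ α β₁ β₂ init ξ u k).vhat i) := by
  induction k with
  | zero => exact hv₀ i
  | succ k ih => exact ih.trans (Real.sqrt_le_sqrt (le_max_left _ _))

theorem x_run_succ (ξ : ℕ → Ξ) (u : ℕ → Vec d) (k : ℕ) :
    let s := run X F μ (fun _ => α) (fun _ => 0) β₂ init ξ u
    (s (k + 1)).x = mahalanobisProj X (fun i => √((s (k + 1)).vhat i)) ((s k).x - α •
      WithLp.toLp 2 fun i => zoGrad μ (fun y => F y (ξ k)) (u k) (s k).x i /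
        √((s (k + 1)).vhat i)) := by
  simp [run, step]

theorem vhat_run_succ (ξ : ℕ → Ξ) (u : ℕ → Vec d) (k : ℕ) :
    let s := run X F μ (fun _ => α) (fun _ => 0) β₂ init ξ u
    (s (k + 1)).vhat = fun i => max ((s k).vhat i) ((s (k + 1)).v i) := rfl

theorem v_run_succ (ξ : ℕ → Ξ) (u : ℕ → Vec d) (k : ℕ) :
    let s := run X F μ (fun _ => α) (fun _ => 0) β₂ init ξ u
    (s (k + 1)).v = fun i => β₂ * (s k).v i +
      (1 - β₂) * zoGrad μ (fun y => F y (ξ k)) (u k) (s k).x i ^ 2 := rfl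

theorem isProj_run_succ (hXc : IsClosed X) (hne : X.Nonempty) (hc : 0 < c)
    (hv₀ : ∀ i, c ≤ √(init.vhat i)) (ξ : ℕ → Ξ) (u : ℕ → Vec d) (k : ℕ) :
    let s := run X F μ (fun _ => α) (fun _ => 0) β₂ init ξ u
    IsProj X (fun i => √((s (k + 1)).vhat i)) ((s k).x - α •
      WithLp.toLp 2 fun i => zoGrad μ (fun y => F y (ξ k)) (u k) (s k).x i /
        √((s (k + 1)).vhat i)) (s (k + 1)).x := by
  intro s
  have := isProj_mahalanobisProj hXc hne
    (fun i => hc.trans_le (le_sqrt_vhat_run (X := X) (F := F) (μ := μ) (β₂ := β₂) hv₀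
      (fun _ => α) (fun _ => 0) ξ u (k + 1) i))
    ((s k).x - α • WithLp.toLp 2 fun i => zoGrad μ (fun y => F y (ξ k)) (u k) (s k).x i /
        √((s (k + 1)).vhat i))
  rwa [← x_run_succ] at this

theorem x_run_mem (hXc : IsClosed X) (hx₁ : init.x ∈ X) (hc : 0 < c)
    (hv₀ : ∀ i, c ≤ √(init.vhat i)) (ξ : ℕ → Ξ) (u : ℕ → Vec d) (k : ℕ) :
    (run X F μ (fun _ => α) (fun _ => 0) β₂ init ξ u k).x ∈ X := by
  cases k with
  | zero => exact hx₁
  | succ k => exact (isProj_run_succ hXc ⟨_, hx₁⟩ hc hv₀ ξ u k).1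

theorem isProx_run_succ (hXc : IsClosed X) (hne : X.Nonempty) (hα : 0 < α) (hc : 0 < c)
    (hv₀ : ∀ i, c ≤ √(init.vhat i)) (ξ : ℕ → Ξ) (u : ℕ → Vec d) (k : ℕ) :
    let s := run X F μ (fun _ => α) (fun _ => 0) β₂ init ξ u
    IsProx X (fun i => √((s (k + 1)).vhat i)) (s k).x
      (zoGrad μ (fun y => F y (ξ k)) (u k) (s k).x) α (s (k + 1)).x :=
  (isProj_iff_isProx (fun i => hc.trans_le (le_sqrt_vhat_run hv₀ _ _ ξ u (k + 1) i)) hα).1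
    (isProj_run_succ hXc hne hc hv₀ ξ u k)

end Run

/-! ### Measurability of the iterates and of the convergence measure. -/

section Measurability

variable {d : ℕ} {Ξ : Type*} [MeasurableSpace Ξ] {X : Set (Vec d)} {F : Vec d → Ξ → ℝ}
  {μ α β₂ c : ℝ} {init : State d} {Z : Type*} [MeasurableSpace Z]

theorem measurable_zoGrad (hFm : ∀ x, Measurable (F x))
    (hFc : ∀ s, Continuous fun x => F x s) {ξ : Z → Ξ} {u x : Z → Vec d} (hξ : Measurable ξ)
    (hu : Measurable u) (hx : Measurable x) :
    Measurable fun z => zoGrad μ (fun y => F y (ξ z)) (u z) (x z) := by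
  have hF := measurable_uncurry_of_continuous_of_measurable hFc hFm
  have h1 : Measurable fun z => F (x z + μ • u z) (ξ z) :=
    hF.comp ((hx.add (hu.const_smul μ)).prodMk hξ)
  have h2 : Measurable fun z => F (x z) (ξ z) := hF.comp (hx.prodMk hξ)
  exact ((h1.sub h2).const_mul _).smul hu

theorem measurable_vec_apply {x : Z → Vec d} (hx : Measurable x) (i : Fin d) :
    Measurable fun z => x z i :=
  (measurable_pi_apply i).comp ((WithLp.measurable_ofLp 2 _).comp hx)

theorem measurable_mahalanobisProj_step (hXc : IsClosed X) (hX : Convex ℝ X) (hne : X.Nonempty)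
    (hc : 0 < c) {x g : Z → Vec d} {h : Z → Fin d → ℝ} (hx : Measurable x) (hg : Measurable g)
    (hh : Measurable h) (hch : ∀ z i, c ≤ h z i) :
    Measurable fun z => mahalanobisProj X (h z)
      (x z - α • WithLp.toLp 2 fun i => g z i / h z i) := by
  have e : (fun z => mahalanobisProj X (h z) (x z - α • WithLp.toLp 2 fun i => g z i / h z i)) =
      fun z => mahalanobisProj X (fun i => max c (h z i))
        (x z - α • WithLp.toLp 2 fun i => g z i / h z i) := by
    simp only [max_eq_right (hch _ _)]
  rw [e]
  refine (continuous_mahalanobisProj hXc hX hne hc).measurable.comp (hh.prodMk (hx.sub ?_))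
  refine Measurable.const_smul ?_ α
  exact (WithLp.measurable_toLp 2 _).comp (measurable_pi_lambda _ fun i =>
    (measurable_vec_apply hg i).div (measurable_pi_iff.1 hh i))

/-- The three fields are handled in one induction: the new v uses the old iterate, and the new
iterate uses the new v̂. -/
theorem measurable_run (hXc : IsClosed X) (hX : Convex ℝ X) (hne : X.Nonempty) (hc : 0 < c)
    (hv₀ : ∀ i, c ≤ √(init.vhat i)) (hFm : ∀ x, Measurable (F x))
    (hFc : ∀ s, Continuous fun x => F x s) {ξ : Z → ℕ → Ξ} {u : Z → ℕ → Vec d}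
    (hξ : ∀ k, Measurable fun z => ξ z k) (hu : ∀ k, Measurable fun z => u z k) (k : ℕ) :
    let s := fun z => run X F μ (fun _ => α) (fun _ => 0) β₂ init (ξ z) (u z) k
    Measurable (fun z => (s z).x) ∧ Measurable (fun z => (s z).v) ∧
      Measurable fun z => (s z).vhat := by
  induction k with
  | zero => exact ⟨(measurable_const : Measurable fun _ : Z => init.x),
    (measurable_const : Measurable fun _ : Z => init.v), (measurable_const : Measurable fun _ : Z => init.vhat)⟩
  | succ k ih =>
    obtain ⟨hx, hv, hvh⟩ := ih
    have hg := measurable_zoGrad (μ := μ) hFm hFc (hξ k) (hu k) hx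
    have hv' : Measurable fun z =>
        (run X F μ (fun _ => α) (fun _ => 0) β₂ init (ξ z) (u z) (k + 1)).v := by
      simp only [v_run_succ]
      exact measurable_pi_lambda _ fun i => ((measurable_pi_iff.1 hv i).const_mul _).add
        (((measurable_vec_apply hg i).pow_const 2).const_mul _)
    have hvh' : Measurable fun z =>
        (run X F μ (fun _ => α) (fun _ => 0) β₂ init (ξ z) (u z) (k + 1)).vhat := by
      simp only [vhat_run_succ]
      exact measurable_pi_lambda _ fun i =>
        (measurable_pi_iff.1 hvh i).max (measurable_pi_iff.1 hv' i)
    refine ⟨?_, hv', hvh'⟩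
    simp only [x_run_succ]
    exact measurable_mahalanobisProj_step hXc hX hne hc hx hg
      (measurable_pi_lambda _ fun i => (measurable_pi_iff.1 hvh' i).sqrt)
      fun z i => le_sqrt_vhat_run hv₀ _ _ (ξ z) (u z) (k + 1) i

theorem measurable_measureG (hXc : IsClosed X) (hX : Convex ℝ X) (hne : X.Nonempty) (hc : 0 < c)
    (hα : 0 < α) {f : Vec d → ℝ} (hf : Measurable (gradient f)) {x : Z → Vec d}
    {vhat : Z → Fin d → ℝ} (hx : Measurable x) (hv : Measurable vhat)
    (hcv : ∀ z i, c ≤ √(vhat z i)) :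
    Measurable fun z => measureG X f α (x z) (vhat z) := by
  have hh : Measurable fun z i => √(vhat z i) :=
    measurable_pi_lambda _ fun i => (measurable_pi_iff.1 hv i).sqrt
  simp only [measureG, gradMapping]
  simp_rw [fun z => proxPoint_eq_mahalanobisProj X (fun i => hc.trans_le (hcv z i)) (x z)
    (gradient f (x z)) hα]
  exact continuous_wsq.measurable.comp (hh.prodMk ((hx.sub (measurable_mahalanobisProj_step hXc hX
    hne hc hx (hf.comp hx) hh hcv)).const_smul α⁻¹))

theorem continuous_gradient {f : Vec d → ℝ} {L : ℝ}
    (hL : ∀ x y, ‖fderiv ℝ f x - fderiv ℝ f y‖ ≤ L * ‖x - y‖) : Continuous (gradient f) :=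
  (InnerProductSpace.toDual ℝ (Vec d)).symm.continuous.comp (continuous_fderiv_of_lipschitz hL)

end Measurability

/-! ### Random directions and the random index. -/

section Probability

theorem ae_norm_eq_one_uniformSphere (d : ℕ) : ∀ᵐ u ∂uniformSphere d, ‖u‖ = 1 := by
  rw [uniformSphere, ae_map_iff measurable_subtype_coe.aemeasurable
    (measurableSet_eq_fun measurable_norm measurable_const)]
  exact Filter.Eventually.of_forall fun u => by simp

/-- The expectation of a process at an independent uniform index is the average of the
expectations. -/
theorem integral_uniform_index {Ω 𝓩 : Type*} [MeasurableSpace Ω] [MeasurableSpace 𝓩]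
    {Pr : Measure Ω} [IsProbabilityMeasure Pr] {T : ℕ} {R : Ω → Fin T}
    (hR : HasLaw R (uniformOn Set.univ) Pr) {Y : Ω → 𝓩}
    (hind : IndepFun R Y Pr) {Φ : Fin T → 𝓩 → ℝ} (hΦ : ∀ k, Measurable (Φ k))
    (hint : ∀ k, Integrable (fun ω => Φ k (Y ω)) Pr) :
    Integrable (fun ω => Φ (R ω) (Y ω)) Pr ∧
      ∫ ω, Φ (R ω) (Y ω) ∂Pr = 1 / T * ∑ k, ∫ ω, Φ k (Y ω) ∂Pr := by
  let e : Fin T → Fin T → ℝ := fun k => ({k} : Set (Fin T)).indicator 1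
  have he : ∀ k, Measurable (e k) := fun k => measurable_of_finite _
  -- Split over the value of R; independence then factors each expectation into 1/T times that of
  -- the k-th term.
  have hsum : (fun ω => Φ (R ω) (Y ω)) = fun ω => ∑ k, e k (R ω) * Φ k (Y ω) := by
    ext ω
    rw [Finset.sum_eq_single (R ω)]
    · simp [e]
    · intro k _ hk
      simp [e, hk.symm]
    · simp
  have hint' : ∀ k, Integrable (fun ω => e k (R ω) * Φ k (Y ω)) Pr := fun k => by
    refine (hint k).bdd_mul (c := 1) ((he k).comp_aemeasurable hR.aemeasurable).aestronglyMeasurable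
      (Filter.Eventually.of_forall fun ω => ?_)
    by_cases h : R ω = k <;> simp [e, h]
  have hlaw : ∀ k, ∫ ω, e k (R ω) ∂Pr = 1 / T := by
    intro k
    have h1 := hR.integral_comp (f := e k) (he k).aestronglyMeasurable
    simp only [Function.comp_def] at h1
    rw [h1, integral_indicator_one (measurableSet_singleton k), measureReal_def, uniformOn_univ]
    simp
  rw [hsum]
  refine ⟨integrable_finsetSum _ fun k _ => hint' k, ?_⟩
  rw [integral_finsetSum _ fun k _ => hint' k, Finset.mul_sum]
  refine Finset.sum_congr rfl fun k _ => ?_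
  have hk : IndepFun (fun ω => e k (R ω)) (fun ω => Φ k (Y ω)) Pr := hind.comp (he k) (hΦ k)
  rw [hk.integral_fun_mul_eq_mul_integral
    ((he k).comp_aemeasurable hR.aemeasurable).aestronglyMeasurable
    (hint k).aestronglyMeasurable, hlaw]

end Probability

theorem norm_le_sqrt_mul {d : ℕ} {η : ℝ} (hη : 0 ≤ η) {z : Vec d} (hz : ∀ i, |z i| ≤ η) :
    ‖z‖ ≤ √d * η := by
  rw [EuclideanSpace.norm_eq]
  refine Real.sqrt_le_iff.2 ⟨by positivity, ?_⟩
  rw [mul_pow, Real.sq_sqrt (Nat.cast_nonneg d)]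
  refine (Finset.sum_le_sum fun i _ => pow_le_pow_left₀ (norm_nonneg (z i)) (hz i) 2).trans ?_
  simp

end ZOAdaMM

/-! ### Assembly of the convergence bound. -/

open ZOAdaMM

theorem theorem2
    {d T : ℕ} (hd : 0 < d) (hT : 0 < T)
    {Ξ : Type*} [MeasurableSpace Ξ] (P : Measure Ξ) [IsProbabilityMeasure P]
    {Ω : Type*} [MeasurableSpace Ω] (Pr : Measure Ω) [IsProbabilityMeasure Pr]
    -- the constraint set and the stochastic objective `F x s = f(x; s)`
    (X : Set (ZOAdaMM.Vec d)) (hXclosed : IsClosed X) (hXconvex : Convex ℝ X)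
    (F : ZOAdaMM.Vec d → Ξ → ℝ)
    (hFmeas : ∀ x, Measurable (F x)) (hFint : ∀ x, Integrable (F x) P)
    -- Lipschitz continuous gradients
    (Lg : ℝ) (hLg : 0 < Lg)
    (hdiff : ∀ s, Differentiable ℝ (fun x => F x s))
    (hlip : ∀ s x y, ‖gradient (fun z => F z s) x - gradient (fun z => F z s) y‖ ≤ Lg * ‖x - y‖)
    -- bounded stochastic gradients
    (η : ℝ) (hbdd : ∀ s x i, |gradient (fun z => F z s) x i| ≤ η)
    -- parameters and initialization of the algorithm
    (c α β₂ μ Df : ℝ) (hc : 0 < c) (hα : 0 < α) (hαc : α ≤ c / Lg)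
    (hβ₂ : 0 < β₂) (hβ₂' : β₂ ≤ 1) (hμ : μ = 1 / √((T : ℝ) * d))
    (init : ZOAdaMM.State d) (hx₁ : init.x ∈ X) (hv₀ : ∀ i, c ≤ √(init.vhat i))
    (hDf : ∀ x ∈ X, ZOAdaMM.smoothing μ (ZOAdaMM.objective P F) init.x
      - ZOAdaMM.smoothing μ (ZOAdaMM.objective P F) x ≤ Df)
    -- the random samples, the random directions and the random index
    (ξ : ℕ → Ω → Ξ) (u : ℕ → Ω → ZOAdaMM.Vec d) (R : Ω → Fin T)
    (hξ : ∀ k, HasLaw (ξ k) P Pr) (hu : ∀ k, HasLaw (u k) (ZOAdaMM.uniformSphere d) Pr)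
    (hξu : ∀ k, IndepFun (ξ k) (u k) Pr)
    (hindep : iIndepFun (fun k ω => (ξ k ω, u k ω)) Pr)
    (hR : HasLaw R (uniformOn Set.univ) Pr)
    (hRindep : IndepFun R (fun ω k => (ξ k ω, u k ω)) Pr) :
    let f : ZOAdaMM.Vec d → ℝ := ZOAdaMM.objective P F
    let S : ℕ → Ω → ZOAdaMM.State d := fun k ω =>
      ZOAdaMM.run X F μ (fun _ => α) (fun _ => 0) β₂ init (fun j => ξ j ω) (fun j => u j ω) k
    -- `‖G(x_t)‖²` and `‖ĝ_t - ∇f_μ(x_t)‖²` for `t = k + 1`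
    let G : ℕ → Ω → ℝ := fun k ω => ZOAdaMM.measureG X f α (S k ω).x (S (k + 1) ω).vhat
    let N : ℕ → Ω → ℝ := fun k ω =>
      ‖ZOAdaMM.zoGrad μ (fun y => F y (ξ k ω)) (u k ω) (S k ω).x
        - gradient (ZOAdaMM.smoothing μ f) (S k ω).x‖ ^ 2
    let σ : ℝ := ⨆ k : Fin T, ∫ ω, N k ω ∂Pr
    Integrable (fun ω => G (R ω) ω) Pr ∧ (∀ k : Fin T, Integrable (N k) Pr) ∧
    ∫ ω, G (R ω) ω ∂Pr ≤
      6 * Df / (α * T) + 3 * Lg ^ 2 * d / (4 * c * T)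
        + 6 * η ^ 2 / (c ^ 4 * T) * (σ + d * η ^ 2)
        + (3 * c + 9) / c * σ := by
  intro f S G N σ
  have hT' : (0 : ℝ) < T := by exact_mod_cast hT
  have hd' : (0 : ℝ) < d := by exact_mod_cast hd
  have hμ0 : 0 < μ := by rw [hμ]; positivity
  have hne : X.Nonempty := ⟨_, hx₁⟩
  obtain ⟨s₀⟩ : Nonempty Ξ := nonempty_of_isProbabilityMeasure P
  have hη : 0 ≤ η := (abs_nonneg _).trans (hbdd s₀ 0 ⟨0, hd⟩)
  set B : ℝ := √d * η
  have hFB : ∀ s x, ‖fderiv ℝ (fun z => F z s) x‖ ≤ B := fun s x => by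
    rw [← norm_gradient]; exact norm_le_sqrt_mul hη (hbdd s x)
  have hFL : ∀ s x y, ‖fderiv ℝ (fun z => F z s) x - fderiv ℝ (fun z => F z s) y‖ ≤
      Lg * ‖x - y‖ := fun s x y => by
    rw [← norm_gradient_sub]; exact hlip s x y
  have hFc : ∀ s, Continuous fun x => F x s := fun s => (hdiff s).continuous
  have hf : Differentiable ℝ f := fun x =>
    (hasFDerivAt_objective hFmeas hFint hdiff hFB x).differentiableAt
  have hfB : ∀ x, ‖fderiv ℝ f x‖ ≤ B := norm_fderiv_objective_le hFmeas hFint hdiff hFB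
  have hfL : ∀ x y, ‖fderiv ℝ f x - fderiv ℝ f y‖ ≤ Lg * ‖x - y‖ :=
    norm_fderiv_objective_sub_le hFmeas hFint hdiff hFB hFL
  have hφ : Differentiable ℝ (smoothing μ f) := fun x =>
    (hasFDerivAt_smoothing hf hfB μ x).differentiableAt
  have hφB := norm_fderiv_smoothing_le hf hfB μ
  have hφL := norm_fderiv_smoothing_sub_le hf hfB hfL μ
  have hbias : ∀ x, ‖gradient f x - gradient (smoothing μ f) x‖ ≤ Lg * μ * d / 2 := fun x => by
    rw [norm_gradient_sub]
    exact norm_fderiv_sub_fderiv_smoothing_le hd hf hμ0.le hLg.le hfB hfL x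
  have hαL : α * Lg ≤ c := (le_div_iff₀ hLg).1 hαc
  have hSx : ∀ k ω, (S k ω).x ∈ X := fun k ω => x_run_mem hXclosed hx₁ hc hv₀ _ _ k
  have hSv : ∀ k ω i, c ≤ √((S k ω).vhat i) := fun k ω i => le_sqrt_vhat_run hv₀ _ _ _ _ k i
  -- the process as a function of the samples and directions
  let Y : Ω → ℕ → Ξ × Vec d := fun ω k => (ξ k ω, u k ω)
  have hY : AEMeasurable Y Pr :=
    aemeasurable_pi_iff.2 fun k => (hξ k).aemeasurable.prodMk (hu k).aemeasurable
  let S' : ℕ → (ℕ → Ξ × Vec d) → State d := fun k z =>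
    run X F μ (fun _ => α) (fun _ => 0) β₂ init (fun j => (z j).1) (fun j => (z j).2) k
  have hmξ : ∀ k, Measurable fun z : ℕ → Ξ × Vec d => (z k).1 := fun k =>
    measurable_fst.comp (measurable_pi_apply k)
  have hmu : ∀ k, Measurable fun z : ℕ → Ξ × Vec d => (z k).2 := fun k =>
    measurable_snd.comp (measurable_pi_apply k)
  have hmS : ∀ k, Measurable (fun z => (S' k z).x) ∧ Measurable (fun z => (S' k z).v) ∧
      Measurable fun z => (S' k z).vhat :=
    measurable_run hXclosed hXconvex hne hc hv₀ hFmeas hFc hmξ hmu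
  have hmG : ∀ k, Measurable fun z => measureG X f α (S' k z).x (S' (k + 1) z).vhat := fun k =>
    measurable_measureG hXclosed hXconvex hne hc hα (continuous_gradient hfL).measurable
      (hmS k).1 (hmS (k + 1)).2.2 fun z i => le_sqrt_vhat_run hv₀ _ _ _ _ (k + 1) i
  have hmN : ∀ k, Measurable fun z => ‖zoGrad μ (fun y => F y (z k).1) (z k).2 (S' k z).x
      - gradient (smoothing μ f) (S' k z).x‖ ^ 2 := fun k =>
    ((measurable_zoGrad hFmeas hFc (hmξ k) (hmu k) (hmS k).1).sub
      ((continuous_gradient hφL).measurable.comp (hmS k).1)).norm.pow_const 2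
  have hGint : ∀ k, Integrable (G k) Pr := by
    intro k
    refine Integrable.of_bound ((hmG k).comp_aemeasurable hY).aestronglyMeasurable (B ^ 2 / c)
      (Filter.Eventually.of_forall fun ω => ?_)
    have h0 : 0 ≤ G k ω :=
      (mul_nonneg hc.le (sq_nonneg _)).trans (mul_norm_sq_le_wsq (hSv (k + 1) ω) _)
    rw [Real.norm_of_nonneg h0]
    refine (wsq_gradMapping_le_norm_sq hXclosed hXconvex hc hα (hSv (k + 1) ω) (hSx k ω) _).trans ?_
    rw [norm_gradient]
    exact div_le_div_of_nonneg_right (pow_le_pow_left₀ (norm_nonneg _) (hfB _) 2) hc.le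
  have hNint : ∀ k, Integrable (N k) Pr := by
    intro k
    refine Integrable.of_bound ((hmN k).comp_aemeasurable hY).aestronglyMeasurable
      ((d * B + B) ^ 2) ?_
    -- Only the law of the direction is prescribed, so it has unit length almost surely and the
    -- bound on N is an almost sure one.
    have hnorm : ∀ᵐ ω ∂Pr, ‖u k ω‖ = 1 := ((hu k).ae_iff
      (measurableSet_eq_fun measurable_norm measurable_const).mem).2 (ae_norm_eq_one_uniformSphere d)
    filter_upwards [hnorm] with ω hω
    rw [Real.norm_of_nonneg (sq_nonneg _)]
    refine pow_le_pow_left₀ (norm_nonneg _) ((norm_sub_le _ _).trans (add_le_add ?_ ?_)) 2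
    · exact norm_zoGrad_le (hdiff _) (hFB _) hμ0 hω _
    · rw [norm_gradient]; exact hφB _
  -- the pathwise bound
  have hpath : ∀ ω, ∑ k : Fin T, G k ω ≤ 3 / α * Df + 3 / (2 * c) * ∑ k : Fin T, N k ω +
      T * (3 / c * (Lg * μ * d / 2) ^ 2) := by
    intro ω
    have hstep : ∀ k, G k ω ≤ 3 / α * (smoothing μ f (S k ω).x - smoothing μ f (S (k + 1) ω).x) +
        3 / (2 * c) * N k ω + 3 / c * (Lg * μ * d / 2) ^ 2 := fun k =>
      wsq_gradMapping_le hXclosed hXconvex hc hα hαL (hSv (k + 1) ω) hφ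
        (fun x y => by rw [norm_gradient_sub]; exact hφL x y) (hSx k ω) (hbias _)
        (isProx_run_succ hXclosed hne hα hc hv₀ _ _ k)
    rw [Fin.sum_univ_eq_sum_range (fun k => G k ω), Fin.sum_univ_eq_sum_range (fun k => N k ω)]
    refine (Finset.sum_le_sum fun k _ => hstep k).trans ?_
    rw [Finset.sum_add_distrib, Finset.sum_add_distrib, ← Finset.mul_sum, ← Finset.mul_sum,
      Finset.sum_range_sub' (fun k => smoothing μ f (S k ω).x), Finset.sum_const, Finset.card_range,
      nsmul_eq_mul]
    have := mul_le_mul_of_nonneg_left (hDf _ (hSx T ω)) (by positivity : 0 ≤ 3 / α)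
    gcongr
    exact hDf _ (hSx T ω)
  have hmean : ∑ k : Fin T, ∫ ω, G k ω ∂Pr ≤ 3 / α * Df + 3 / (2 * c) * ∑ k : Fin T, ∫ ω, N k ω ∂Pr
      + T * (3 / c * (Lg * μ * d / 2) ^ 2) := by
    have hsN : Integrable (fun ω => ∑ k : Fin T, N k ω) Pr := integrable_finsetSum _ fun k _ => hNint k
    have h1 := integral_mono (integrable_finsetSum _ fun (k : Fin T) _ => hGint k)
      (((integrable_const (3 / α * Df)).add (hsN.const_mul (3 / (2 * c)))).add
        (integrable_const (T * (3 / c * (Lg * μ * d / 2) ^ 2)))) hpath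
    rw [integral_finsetSum _ fun (k : Fin T) _ => hGint k] at h1
    refine h1.trans_eq ?_
    rw [integral_add' ((integrable_const _).add (hsN.const_mul _)) (integrable_const _),
      integral_add' (integrable_const _) (hsN.const_mul _),
      integral_const_mul (3 / (2 * c)),
      integral_finsetSum _ fun (k : Fin T) _ => hNint k]
    simp
  -- Finiteness of the index set guarantees that the real supremum is a genuine upper bound.
  have hσN : ∀ k : Fin T, ∫ ω, N k ω ∂Pr ≤ σ := fun k =>
    le_ciSup (f := fun k : Fin T => ∫ ω, N k ω ∂Pr) (Set.finite_range _).bddAbove k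
  have hσ : 0 ≤ σ := (integral_nonneg fun ω => sq_nonneg _).trans (hσN ⟨0, hT⟩)
  have hDf0 : 0 ≤ Df := by simpa using hDf _ hx₁
  have hsumN : ∑ k : Fin T, ∫ ω, N k ω ∂Pr ≤ T * σ := by
    simpa using Finset.sum_le_sum fun (k : Fin T) (_ : k ∈ Finset.univ) => hσN k
  obtain ⟨hint, heq⟩ := integral_uniform_index hR hRindep (fun k => hmG k) fun k => hGint k
  refine ⟨hint, fun k => hNint k, ?_⟩
  -- The choice of μ turns the squared bias L_g²μ²d²/4 into L_g²d/(4T).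
  have hμ2 : μ ^ 2 * (T * d) = 1 := by
    rw [hμ, div_pow, Real.sq_sqrt (by positivity)]
    field_simp
  calc ∫ ω, G (R ω) ω ∂Pr = 1 / T * ∑ k : Fin T, ∫ ω, G k ω ∂Pr := heq
    _ ≤ 1 / T * (3 / α * Df + 3 / (2 * c) * (T * σ) + T * (3 / c * (Lg * μ * d / 2) ^ 2)) := by
      refine mul_le_mul_of_nonneg_left (hmean.trans ?_) (by positivity)
      gcongr
    _ = 3 * Df / (α * T) + 3 * Lg ^ 2 * d / (4 * c * T) + 3 / 2 / c * σ := by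
      have e : T * (3 / c * (Lg * μ * d / 2) ^ 2) = 3 * Lg ^ 2 * d / (4 * c) := by
        calc _ = 3 * Lg ^ 2 * d / (4 * c) * (μ ^ 2 * (T * d)) := by field_simp; ring
          _ = _ := by rw [hμ2, mul_one]
      rw [e]
      field_simp
      ring
    _ ≤ _ := by
      -- The bound reached is already sharper than the target: constants are enlarged, and the term
      -- in η²/c⁴ enters only through its nonnegativity.
      have h1 : 3 * Df / (α * T) ≤ 6 * Df / (α * T) := by gcongr; norm_num
      have h2 : 0 ≤ 6 * η ^ 2 / (c ^ 4 * T) * (σ + d * η ^ 2) := by positivity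
      have h3 : 3 / 2 / c * σ ≤ (3 * c + 9) / c * σ := by gcongr; linarith
      linarith
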